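/- **Theorem 3 (Non-linear sewing lemma, weak formulation).** Let $V$ be a finite-dimensional real normed space with distance $d(a,b)=|a-b|$. Let the following be given. * A *control* $\omega$ on $[0,\infty)$: numbers $\omega_{s,t}\ge 0$ for $0\le s\le t<\infty$ with $\omega_{s,s}=0$, $\omega_{r,s}+\omega_{s,t}\le\omega_{r,t}$ for $r\le s\le t$, and such that for all $H,\varepsilon>0$ there is $h>0$ with $\omega_{s,t}<\varepsilon$ whenever $s\le t\le s+h$ and $t\le H$. * A *remainder* $\varpi$: a continuous increasing function $\varpi:[0,\infty)\to[0,\infty)$ with $2\varpi(x/2)\le\varkappa\,\varpi(x)$ for all $x>0$, where $0<\varkappa<1$. * A bounded Lipschitz function $N:V\to[1,\infty)$. * A time horizon $T\in(0,\infty]$ and a constant $\delta_T\ge 0$ such that $\varkappa(1+\delta_T)<1$. * A *Lipschitz almost flow* $\phi$: a family of maps $\phi_{t,s}:V\to V$, $0\le s\le t<\infty$, such that $(s,t)\mapsto\phi_{t,s}(a)$ is continuous for each $a\in V$ and, for all $a,b\in V$, $\phi_{t,t}(a)=a$ for all $t\ge 0$; $d(\phi_{t,s}(a),a)\le\delta_T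 N(a)$ and $d(\phi_{t,s}(a),\phi_{t,s}(b))\le(1+\delta_T)\,d(a,b)$ for all $s\le t$ with $t-s\le T$; $d(\phi_{t,s}(\phi_{s,r}(a)),\phi_{t,r}(a))\le N(a)\,\varpi(\omega_{r,t})$ for all $r\le s\le t$. Then there is a family of maps $\psi_{t,s}:V\to V$, $0\le s\le t<\infty$, such that 1. $\psi$ is a flow: $\psi_{t,t}(a)=a$ and $\psi_{t,s}(\psi_{s,r}(a))=\psi_{t,r}(a)$ for all $a\in V$ and $r\le s\le t$; moreover $t\in[s,\infty)\mapsto\psi_{t,s}(a)$ is continuous for all $s\ge0$, $a\in V$; 2. $\psi$ is in the same galaxy as $\phi$: for every $H<\infty$, and also for $H=\infty$ if $T=\infty$, there is a constant $C$ such that $d(\phi_{t,s}(a),\psi_{t,s}(a))\le C\,N(a)\,\varpi(\omega_{s,t})$ for all $a\in V$ and all $s\le t$ with $t-s\le H$; 3. $\psi_{t,s}$ is Borel measurable for all $s\le t$. No uniqueness of solutions (D-solutions) associated with $\phi$ is assumed. -/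

import Mathlib

open scoped NNReal ENNReal

namespace Sewing

/-- A control on the time half-line `[0, ∞)`: a super-additive family `ω s t`, `s ≤ t`, of nonnegative
numbers which vanishes on the diagonal and is small near it, uniformly on each bounded horizon `[0, H]`.
The values `ω s t` for `t < s` play no role. -/
structure IsControl (ω : ℝ≥0 → ℝ≥0 → ℝ≥0) : Prop where
  superadditive : ∀ r s t, r ≤ s → s ≤ t → ω r s + ω s t ≤ ω r t
  diag : ∀ s, ω s s = 0
  small : ∀ H : ℝ≥0, ∀ ε > 0, ∃ h > 0, ∀ s t, s ≤ t → t ≤ s + h → t ≤ H → ω s t < ε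

/-- A remainder: a continuous increasing function `ϖ : [0, ∞) → [0, ∞)` such that
`2 ϖ(x / 2) ≤ ϰ ϖ(x)` for all `x > 0`, where `0 < ϰ < 1`. -/
structure IsRemainder (ϖ : ℝ≥0 → ℝ≥0) (ϰ : ℝ≥0) : Prop where
  continuous : Continuous ϖ
  strictMono : StrictMono ϖ
  pos : 0 < ϰ
  lt_one : ϰ < 1
  two_mul_half_le : ∀ x > 0, 2 * ϖ (x / 2) ≤ ϰ * ϖ x

variable {V : Type*} [PseudoMetricSpace V]

/-- The class of families `φ t s : V → V`, `0 ≤ s ≤ t < ∞`, for which `(s, t) ↦ φ t s a` is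
continuous on `{s ≤ t}` for each `a`. -/
def IsContinuousFamily (φ : ℝ≥0 → ℝ≥0 → V → V) : Prop :=
  ∀ a, ContinuousOn (fun p : ℝ≥0 × ℝ≥0 => φ p.2 p.1 a) {p | p.1 ≤ p.2}

/-- `φ` is a Lipschitz almost flow on the time half-line `[0, ∞)`, for the time horizon
`T ∈ (0, ∞]` with constant `δT`: the bounds in which `δT` occurs are required on all time windows of
length at most `T` (so for all `s ≤ t` if `T = ∞`). -/
structure IsLipschitzAlmostFlow (N : V → ℝ) (ω : ℝ≥0 → ℝ≥0 → ℝ≥0) (ϖ : ℝ≥0 → ℝ≥0)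
    (T : ℝ≥0∞) (δT : ℝ≥0) (φ : ℝ≥0 → ℝ≥0 → V → V) : Prop where
  continuousFamily : IsContinuousFamily φ
  one_le : ∀ a, 1 ≤ N a
  lipschitz : ∃ K, LipschitzWith K N
  diag : ∀ t a, φ t t a = a
  dist_self_le : ∀ s t : ℝ≥0, s ≤ t → (t : ℝ≥0∞) ≤ s + T → ∀ a,
    dist (φ t s a) a ≤ δT * N a
  dist_le : ∀ s t : ℝ≥0, s ≤ t → (t : ℝ≥0∞) ≤ s + T → ∀ a b,
    dist (φ t s a) (φ t s b) ≤ (1 + δT) * dist a b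
  dist_comp_le : ∀ r s t, r ≤ s → s ≤ t → ∀ a,
    dist (φ t s (φ s r a)) (φ t r a) ≤ N a * ϖ (ω r t)

/-- The flow property. No continuity in `(s, t)` is part of the definition. -/
structure IsFlow (ψ : ℝ≥0 → ℝ≥0 → V → V) : Prop where
  diag : ∀ t a, ψ t t a = a
  comp : ∀ r s t, r ≤ s → s ≤ t → ∀ a, ψ t s (ψ s r a) = ψ t r a

/-- The galaxy relation for pairs of times `s ≤ t` with `t - s ≤ H`. For `H < ∞` this contains the
galaxy relation on the horizon `[0, H]`; for `H = ∞` it is the galaxy relation on `[0, ∞)`, with one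
constant for all times. -/
def SameGalaxy (N : V → ℝ) (ω : ℝ≥0 → ℝ≥0 → ℝ≥0) (ϖ : ℝ≥0 → ℝ≥0) (H : ℝ≥0∞)
    (φ ψ : ℝ≥0 → ℝ≥0 → V → V) : Prop :=
  ∃ C : ℝ, ∀ a, ∀ s t : ℝ≥0, s ≤ t → (t : ℝ≥0∞) ≤ s + H →
    dist (φ t s a) (ψ t s a) ≤ C * N a * ϖ (ω s t)

end Sewing

/-!
The flow is obtained by selecting, for each starting point, one path among many.

*D-solutions.* A path `y` is a D-solution if `dist (y t) (φ t r (y r)) ≤ K * ϖ (ω r t)` on all windows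
of length at most `T`. As `N` is bounded, it may be replaced by a constant `M` throughout. Cutting a
window into two `ω`-halves turns a bound with constant `K` into one with constant `θ * K + 2 * M`, where
`θ = ϰ * (2 + δ) / 2 < 1` (`dist_le_of_halves`). Hence a D-solution with any constant is one with the
universal constant `L = 2 * M / (1 - θ)` (`IsDSolution.sewingConst`), and the schemes which follow `φ`
along a finite set of times satisfy the same bound (`isDSolution_of_scheme`). The control need not be
continuous, so the cut is made at two neighbouring times instead of one.

*The sets of solutions.* Let `S s a` be the set of D-solutions with constant `L` issued from `a` at
time `s`. For the topology of pointwise convergence it is closed and contained in a product of balls,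
so compact, and it is nonempty by compactness applied to the schemes (`solutions_nonempty`). It is
stable under restriction to later times and, because the universal constant absorbs the loss at the
junction, under splicing (`splice_mem_solutions`). The set of `a` for which `S s a` meets a given closed
set is a countable union of compact sets. D-solutions are continuous (`IsDSolution.continuousOn`).

*Selection.* In the manner of Krylov's Markov selection, keep among the paths of `S s a` those which
maximise a continuous function of the position at a time `q` (if `s ≤ q`). By dynamic programming the
reduced family has all the properties above (`IsSelectable.maximisers`); measurability survives
because comparing two maxima amounts to comparing countably many conditions of hitting a closed set. Doing
this successively for a countable family of times and functions which separates continuous paths leaves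
exactly one path for each `(s, a)` (`IsSelectable.exists_flow`). Stability under restriction is then the
flow property, and the bound for D-solutions is the galaxy relation.
-/

open Filter Topology

namespace Sewing

/-! ### Error estimates for D-solutions -/

section Estimates

lemma IsControl.mono {ω : ℝ≥0 → ℝ≥0 → ℝ≥0} (hω : IsControl ω) {r r' t' t : ℝ≥0}
    (h₁ : r ≤ r') (h₂ : r' ≤ t') (h₃ : t' ≤ t) : ω r' t' ≤ ω r t :=
  calc ω r' t' ≤ ω r' t' + ω t' t := le_self_add
    _ ≤ ω r' t := hω.superadditive _ _ _ h₂ h₃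
    _ ≤ ω r r' + ω r' t := le_add_self
    _ ≤ ω r t := hω.superadditive _ _ _ h₁ (h₂.trans h₃)

/-- An approximate midpoint. Since `ω` need not be continuous, a point which halves `ω r t` need not
exist, but two points at an arbitrarily small `ω`-distance do the job. -/
lemma IsControl.exists_split {ω : ℝ≥0 → ℝ≥0 → ℝ≥0} (hω : IsControl ω) {r t : ℝ≥0} (hrt : r ≤ t)
    {η : ℝ≥0} (hη : 0 < η) :
    ∃ v v', r ≤ v ∧ v ≤ v' ∧ v' ≤ t ∧ ω r v ≤ ω r t / 2 ∧ ω v' t ≤ ω r t / 2 ∧ ω v v' < η := by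
  obtain ⟨h, hpos, hsmall⟩ := hω.small t η hη
  have key : ∃ v, r ≤ v ∧ v ≤ t ∧ ω r v ≤ ω r t / 2 ∧
      (v + h ≤ t → ω r t / 2 < ω r (v + h)) := by
    by_contra! hcon
    have step : ∀ n : ℕ, r + n * h ≤ t ∧ ω r (r + n * h) ≤ ω r t / 2 := by
      intro n
      induction n with
      | zero => simpa [hω.diag] using hrt
      | succ n ih =>
        have := hcon (r + n * h) le_self_add ih.1 ih.2
        have e : r + ((n + 1 : ℕ) : ℝ≥0) * h = r + n * h + h := by push_cast; ring
        rwa [e]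
    obtain ⟨n, hn⟩ := exists_nat_gt (t / h)
    rw [div_lt_iff₀ hpos] at hn
    exact absurd ((step n).1) (not_le.2 (hn.trans_le le_add_self))
  obtain ⟨v, hrv, hvt, hv, hv'⟩ := key
  rcases le_total (v + h) t with hle | hle
  · refine ⟨v, v + h, hrv, le_self_add, hle, hv, ?_, hsmall _ _ le_self_add le_rfl hle⟩
    have h₁ := hω.superadditive r (v + h) t (hrv.trans le_self_add) hle
    have h₂ := hv' hle
    rw [← NNReal.coe_le_coe] at h₁ ⊢
    rw [← NNReal.coe_lt_coe] at h₂
    push_cast at h₁ h₂ ⊢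
    linarith
  · exact ⟨v, t, hrv, hvt, le_rfl, hv, by simp [hω.diag], hsmall _ _ hvt hle le_rfl⟩

variable {ϖ : ℝ≥0 → ℝ≥0} {ϰ : ℝ≥0}

lemma IsRemainder.zero (hϖ : IsRemainder ϖ ϰ) : ϖ 0 = 0 := by
  have h₁ : Tendsto (fun x : ℝ≥0 => 2 * ϖ (x / 2)) (𝓝[>] 0) (𝓝 (2 * ϖ (0 / 2))) :=
    (Continuous.tendsto (continuous_const.mul (hϖ.continuous.comp (by fun_prop))) 0).mono_left
      nhdsWithin_le_nhds
  have h₂ : Tendsto (fun x : ℝ≥0 => ϰ * ϖ x) (𝓝[>] 0) (𝓝 (ϰ * ϖ 0)) :=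
    (Continuous.tendsto (continuous_const.mul hϖ.continuous) 0).mono_left nhdsWithin_le_nhds
  have h : 2 * ϖ (0 / 2) ≤ ϰ * ϖ 0 :=
    le_of_tendsto_of_tendsto h₁ h₂
      (eventually_mem_nhdsWithin.mono fun x hx => hϖ.two_mul_half_le x hx)
  rw [zero_div] at h
  have h' : ϰ * ϖ 0 ≤ 1 * ϖ 0 := by gcongr; exact hϖ.lt_one.le
  have := h.trans h'
  rw [← NNReal.coe_le_coe] at this
  push_cast at this
  have h0 := (ϖ 0).coe_nonneg
  exact NNReal.coe_eq_zero.1 (by linarith)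

lemma IsRemainder.half_le (hϖ : IsRemainder ϖ ϰ) (x : ℝ≥0) :
    (ϖ (x / 2) : ℝ) ≤ ϰ / 2 * ϖ x := by
  rcases eq_or_ne x 0 with rfl | hx
  · simp [hϖ.zero]
  · have h := hϖ.two_mul_half_le x (pos_iff_ne_zero.2 hx)
    rw [← NNReal.coe_le_coe] at h
    push_cast at h
    linarith

lemma IsRemainder.mono (hϖ : IsRemainder ϖ ϰ) {x y : ℝ≥0} (h : x ≤ y) : (ϖ x : ℝ) ≤ ϖ y :=
  NNReal.coe_le_coe.2 (hϖ.strictMono.monotone h)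

lemma window_mono {T : ℝ≥0∞} {r v v' t : ℝ≥0} (h : (t : ℝ≥0∞) ≤ r + T) (h₁ : r ≤ v)
    (h₂ : v' ≤ t) : (v' : ℝ≥0∞) ≤ v + T :=
  calc (v' : ℝ≥0∞) ≤ t := by exact_mod_cast h₂
    _ ≤ r + T := h
    _ ≤ v + T := by gcongr

lemma window_of_le_add {T : ℝ≥0∞} {τ r t : ℝ≥0} (hτ : (τ : ℝ≥0∞) ≤ T) (h : t ≤ r + τ) :
    (t : ℝ≥0∞) ≤ r + T :=
  calc (t : ℝ≥0∞) ≤ ((r + τ : ℝ≥0) : ℝ≥0∞) := by exact_mod_cast h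
    _ = r + τ := by push_cast; rfl
    _ ≤ r + T := by gcongr

/-- The factor by which cutting a time window into two halves decreases the error. -/
noncomputable def halvingFactor (ϰ δ : ℝ≥0) : ℝ := ϰ * (2 + δ) / 2

lemma halvingFactor_nonneg (ϰ δ : ℝ≥0) : 0 ≤ halvingFactor ϰ δ := by
  unfold halvingFactor; positivity

lemma halvingFactor_lt_one {δ : ℝ≥0} (hϖ : IsRemainder ϖ ϰ) (hϰ : ϰ * (1 + δ) < 1) :
    halvingFactor ϰ δ < 1 := by
  have h₁ := hϖ.lt_one
  rw [← NNReal.coe_lt_coe] at h₁ hϰ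
  push_cast at h₁ hϰ
  unfold halvingFactor
  linarith

/-- The universal constant of D-solutions: the fixed point of `K ↦ halvingFactor ϰ δ * K + 2 * M`. -/
noncomputable def sewingConst (ϰ δ : ℝ≥0) (M : ℝ) : ℝ := 2 * M / (1 - halvingFactor ϰ δ)

lemma halvingFactor_mul_sewingConst {δ : ℝ≥0} (M : ℝ) (h : halvingFactor ϰ δ < 1) :
    halvingFactor ϰ δ * sewingConst ϰ δ M + 2 * M = sewingConst ϰ δ M := by
  have : 1 - halvingFactor ϰ δ ≠ 0 := by linarith
  unfold sewingConst
  field_simp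
  ring

lemma sewingConst_nonneg {δ : ℝ≥0} {M : ℝ} (hM : 1 ≤ M) (h : halvingFactor ϰ δ < 1) :
    0 ≤ sewingConst ϰ δ M :=
  div_nonneg (by linarith) (by linarith)

variable {V : Type*} [PseudoMetricSpace V] {ω : ℝ≥0 → ℝ≥0 → ℝ≥0} {T : ℝ≥0∞} {δ : ℝ≥0} {M K : ℝ}
  {φ : ℝ≥0 → ℝ≥0 → V → V} {y : ℝ≥0 → V} {P : Set ℝ≥0}

/-- A bounded `N` may be replaced by a constant. -/
lemma IsLipschitzAlmostFlow.of_le {N : V → ℝ} (hφ : IsLipschitzAlmostFlow N ω ϖ T δ φ)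
    (hM : 1 ≤ M) (hN : ∀ a, N a ≤ M) : IsLipschitzAlmostFlow (fun _ => M) ω ϖ T δ φ where
  continuousFamily := hφ.continuousFamily
  one_le _ := hM
  lipschitz := ⟨0, LipschitzWith.const M⟩
  diag := hφ.diag
  dist_self_le s t hst hT a := (hφ.dist_self_le s t hst hT a).trans (by gcongr; exact hN a)
  dist_le := hφ.dist_le
  dist_comp_le r s t hrs hst a := (hφ.dist_comp_le r s t hrs hst a).trans (by gcongr; exact hN a)

/-- `y` is a D-solution with constant `K` at the times in `P`: on each window of length at most `T`
it is followed by `φ` up to an error `K * ϖ (ω r t)`. -/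
def IsDSolution (φ : ℝ≥0 → ℝ≥0 → V → V) (ω : ℝ≥0 → ℝ≥0 → ℝ≥0) (ϖ : ℝ≥0 → ℝ≥0) (T : ℝ≥0∞)
    (K : ℝ) (P : Set ℝ≥0) (y : ℝ≥0 → V) : Prop :=
  ∀ r ∈ P, ∀ t ∈ P, r ≤ t → (t : ℝ≥0∞) ≤ r + T → dist (y t) (φ t r (y r)) ≤ K * ϖ (ω r t)

/-- The error on `[r, t]` in terms of the errors on `[r, v]`, `[v, v']` and `[v', t]`. Only one factor
`1 + δ` occurs in front of the error on `[r, v]`, because `φ t v' ∘ φ v' v` is compared with `φ t v`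
before the Lipschitz bound is applied; this is what makes `ϰ * (1 + δ) < 1` sufficient. -/
lemma dist_le_of_split (hφ : IsLipschitzAlmostFlow (fun _ => M) ω ϖ T δ φ) (hω : IsControl ω)
    (hϖ : IsRemainder ϖ ϰ) (hM : 1 ≤ M) {r v v' t : ℝ≥0} (hrv : r ≤ v) (hvv : v ≤ v') (hvt : v' ≤ t)
    (hT : (t : ℝ≥0∞) ≤ r + T) (y : ℝ≥0 → V) :
    dist (y t) (φ t r (y r)) ≤ dist (y t) (φ t v' (y v'))
      + (1 + δ) * dist (y v') (φ v' v (y v)) + (1 + δ) * dist (y v) (φ v r (y r))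
      + 2 * M * ϖ (ω r t) := by
  have hrv' := hrv.trans hvv
  have hvt' := hvv.trans hvt
  have h₁ := hφ.dist_le v' t hvt (window_mono hT hrv' le_rfl) (y v') (φ v' v (y v))
  have h₂ := hφ.dist_comp_le v v' t hvv hvt (y v)
  have h₃ := hφ.dist_le v t hvt' (window_mono hT hrv le_rfl) (y v) (φ v r (y r))
  have h₄ := hφ.dist_comp_le r v t hrv hvt' (y r)
  have h₅ : M * ϖ (ω v t) ≤ M * ϖ (ω r t) := by
    gcongr
    exact hϖ.strictMono.monotone (hω.mono hrv hvt' le_rfl)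
  have e₁ := dist_triangle (y t) (φ t v' (y v')) (φ t r (y r))
  have e₂ := dist_triangle (φ t v' (y v')) (φ t v' (φ v' v (y v))) (φ t r (y r))
  have e₃ := dist_triangle (φ t v' (φ v' v (y v))) (φ t v (y v)) (φ t r (y r))
  have e₄ := dist_triangle (φ t v (y v)) (φ t v (φ v r (y r))) (φ t r (y r))
  linarith

lemma dist_le_of_halves (hφ : IsLipschitzAlmostFlow (fun _ => M) ω ϖ T δ φ) (hω : IsControl ω)
    (hϖ : IsRemainder ϖ ϰ) (hM : 1 ≤ M) (hK : 0 ≤ K) {r v v' t : ℝ≥0} (hrv : r ≤ v) (hvv : v ≤ v')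
    (hvt : v' ≤ t) (hT : (t : ℝ≥0∞) ≤ r + T) (hω₁ : ω r v ≤ ω r t / 2) (hω₂ : ω v' t ≤ ω r t / 2)
    (h₁ : dist (y v) (φ v r (y r)) ≤ K * ϖ (ω r v))
    (h₂ : dist (y t) (φ t v' (y v')) ≤ K * ϖ (ω v' t)) :
    dist (y t) (φ t r (y r)) ≤ (halvingFactor ϰ δ * K + 2 * M) * ϖ (ω r t)
      + (1 + δ) * dist (y v') (φ v' v (y v)) := by
  have h := dist_le_of_split hφ hω hϖ hM hrv hvv hvt hT y
  have b₁ : dist (y v) (φ v r (y r)) ≤ K * (ϰ / 2 * ϖ (ω r t)) :=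
    h₁.trans (by gcongr; exact (hϖ.mono hω₁).trans (hϖ.half_le _))
  have b₂ : dist (y t) (φ t v' (y v')) ≤ K * (ϰ / 2 * ϖ (ω r t)) :=
    h₂.trans (by gcongr; exact (hϖ.mono hω₂).trans (hϖ.half_le _))
  have b₃ : (1 + (δ : ℝ)) * dist (y v) (φ v r (y r)) ≤ (1 + δ) * (K * (ϰ / 2 * ϖ (ω r t))) := by
    gcongr
  have e : (halvingFactor ϰ δ * K + 2 * M) * ϖ (ω r t) =
      K * (ϰ / 2 * ϖ (ω r t)) + (1 + δ) * (K * (ϰ / 2 * ϖ (ω r t))) + 2 * M * ϖ (ω r t) := by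
    unfold halvingFactor; ring
  linarith

/-- One improvement step for the constant of a D-solution on a half-line. -/
lemma IsDSolution.improve (hφ : IsLipschitzAlmostFlow (fun _ => M) ω ϖ T δ φ) (hω : IsControl ω)
    (hϖ : IsRemainder ϖ ϰ) (hM : 1 ≤ M) (hK : 0 ≤ K) {s : ℝ≥0}
    (hy : IsDSolution φ ω ϖ T K (Set.Ici s) y) :
    IsDSolution φ ω ϖ T (halvingFactor ϰ δ * K + 2 * M) (Set.Ici s) y := by
  intro r hr t ht hrt hT
  refine le_of_forall_pos_le_add fun ε hε => ?_
  have hlim : Tendsto (fun x : ℝ≥0 => (1 + (δ : ℝ)) * (K * ϖ x)) (𝓝 0) (𝓝 0) := by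
    have hc : Continuous fun x : ℝ≥0 => (1 + (δ : ℝ)) * (K * ϖ x) := by
      have := hϖ.continuous
      fun_prop
    simpa [hϖ.zero] using hc.tendsto 0
  obtain ⟨η, hη, hηε⟩ : ∃ η > 0, ∀ x < η, (1 + (δ : ℝ)) * (K * ϖ x) < ε := by
    obtain ⟨η, hη, h⟩ := (nhds_bot_basis (α := ℝ≥0)).eventually_iff.1 (hlim.eventually_lt_const hε)
    exact ⟨η, hη, fun x hx => h hx⟩
  obtain ⟨v, v', hrv, hvv, hvt, hω₁, hω₂, hω₃⟩ := hω.exists_split hrt hη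
  have hv : s ≤ v := le_trans hr hrv
  have hv' : s ≤ v' := hv.trans hvv
  refine (dist_le_of_halves hφ hω hϖ hM hK hrv hvv hvt hT hω₁ hω₂
    (hy r hr v hv hrv (window_mono hT le_rfl (hvv.trans hvt)))
    (hy v' hv' t ht hvt (window_mono hT (hrv.trans hvv) le_rfl))).trans ?_
  have h := hy v hv v' hv' hvv (window_mono hT hrv hvt)
  gcongr
  exact (by gcongr : _ ≤ (1 + (δ : ℝ)) * (K * ϖ (ω v v'))).trans (hηε _ hω₃).le

/-- The a priori estimate: a D-solution on a half-line with any constant is a D-solution with the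
universal constant. -/
lemma IsDSolution.sewingConst (hφ : IsLipschitzAlmostFlow (fun _ => M) ω ϖ T δ φ)
    (hω : IsControl ω) (hϖ : IsRemainder ϖ ϰ) (hM : 1 ≤ M) (hϰ : ϰ * (1 + δ) < 1) (hK : 0 ≤ K)
    {s : ℝ≥0} (hy : IsDSolution φ ω ϖ T K (Set.Ici s) y) :
    IsDSolution φ ω ϖ T (sewingConst ϰ δ M) (Set.Ici s) y := by
  have hθ := halvingFactor_lt_one hϖ hϰ
  have hθ₀ := halvingFactor_nonneg ϰ δ
  have hL := sewingConst_nonneg hM hθ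
  have hstep : ∀ n : ℕ, IsDSolution φ ω ϖ T
      (Sewing.sewingConst ϰ δ M + halvingFactor ϰ δ ^ n * K) (Set.Ici s) y := by
    intro n
    induction n with
    | zero =>
      intro r hr t ht hrt hT
      refine (hy r hr t ht hrt hT).trans ?_
      gcongr
      simpa using hL
    | succ n ih =>
      have := ih.improve hφ hω hϖ hM (by positivity)
      convert this using 1
      rw [mul_add, pow_succ]
      linarith [halvingFactor_mul_sewingConst (ϰ := ϰ) (δ := δ) M hθ]
  intro r hr t ht hrt hT
  have hlim : Tendsto (fun n : ℕ => (Sewing.sewingConst ϰ δ M + halvingFactor ϰ δ ^ n * K) *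
      (ϖ (ω r t) : ℝ)) atTop (𝓝 ((Sewing.sewingConst ϰ δ M + 0 * K) * ϖ (ω r t))) :=
    (((tendsto_pow_atTop_nhds_zero_of_lt_one hθ₀ hθ).mul_const K).const_add _).mul_const _
  rw [zero_mul, add_zero] at hlim
  exact ge_of_tendsto' hlim fun n => hstep n r hr t ht hrt hT

/-- Growth of D-solutions: `P` contains enough times for `t` to be reached from `s` by steps of
length at most `τ ≤ T`. -/
lemma IsDSolution.dist_le_mul (hφ : IsLipschitzAlmostFlow (fun _ => M) ω ϖ T δ φ)
    (hω : IsControl ω) (hϖ : IsRemainder ϖ ϰ) (hM : 1 ≤ M) (hK : 0 ≤ K) {τ s : ℝ≥0}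
    (hτ : (τ : ℝ≥0∞) ≤ T) (hy : IsDSolution φ ω ϖ T K P y) (hs : s ∈ P) (k : ℕ) :
    ∀ t ∈ P, s ≤ t → t ≤ s + k * τ → (∀ i : ℕ, s + i * τ ≤ t → s + i * τ ∈ P) →
      dist (y t) (y s) ≤ k * (δ * M + K * ϖ (ω s t)) := by
  have hstep : ∀ u ∈ P, ∀ t ∈ P, s ≤ u → u ≤ t → t ≤ u + τ →
      dist (y t) (y u) ≤ δ * M + K * ϖ (ω s t) := by
    intro u hu t ht hsu hut htu
    have hw := window_of_le_add hτ htu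
    have h₁ := hy u hu t ht hut hw
    have h₂ := hφ.dist_self_le u t hut hw (y u)
    have h₃ : K * ϖ (ω u t) ≤ K * ϖ (ω s t) := by
      gcongr
      exact hϖ.strictMono.monotone (hω.mono hsu hut le_rfl)
    linarith [dist_triangle (y t) (φ t u (y u)) (y u)]
  induction k with
  | zero =>
    intro t _ hst hts _
    obtain rfl : t = s := le_antisymm (by simpa using hts) hst
    simp
  | succ k ih =>
    intro t ht hst hts hP
    rcases le_total t (s + k * τ) with hle | hle
    · refine (ih t ht hst hle hP).trans ?_
      gcongr
      simp
    · have hu := hP k hle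
      have h₁ := ih (s + k * τ) hu le_self_add le_rfl fun i hi => hP i (hi.trans hle)
      have h₂ := hstep _ hu t ht le_self_add hle (hts.trans_eq (by push_cast; ring))
      have h₃ : (k : ℝ) * (δ * M + K * ϖ (ω s (s + k * τ))) ≤ k * (δ * M + K * ϖ (ω s t)) := by
        gcongr
        exact hϖ.strictMono.monotone (hω.mono le_rfl le_self_add hle)
      push_cast
      linarith [dist_triangle (y t) (y (s + k * τ)) (y s)]

end Estimates

/-! ### Discrete schemes, closedness and continuity of D-solutions -/

section Schemes

/-- The Euler-type scheme that follows `φ` along a finite set of times. -/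
lemma exists_scheme {V : Type*} (φ : ℝ≥0 → ℝ≥0 → V → V) (a : V) (π : Finset ℝ≥0) :
    ∃ y : ℝ≥0 → V, (∀ r ∈ π, (∀ u ∈ π, r ≤ u) → y r = a) ∧
      ∀ r ∈ π, ∀ t ∈ π, r < t → (∀ u ∈ π, u ≤ r ∨ t ≤ u) → y t = φ t r (y r) := by
  induction π using Finset.induction_on_max with
  | empty => exact ⟨fun _ => a, by simp, by simp⟩
  | insert t₀ π hlt ih =>
    obtain ⟨y, hya, hy⟩ := ih
    rcases π.eq_empty_or_nonempty with rfl | hne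
    · exact ⟨fun _ => a, by simp, by simp⟩
    set m := π.max' hne with hm
    have hmπ : m ∈ π := π.max'_mem hne
    refine ⟨Function.update y t₀ (φ t₀ m (y m)), ?_, ?_⟩
    · intro r hr hmin
      rcases Finset.mem_insert.1 hr with rfl | hr
      · exact absurd (hmin m (Finset.mem_insert_of_mem hmπ)) (not_le.2 (hlt m hmπ))
      · rw [Function.update_of_ne (hlt r hr).ne]
        exact hya r hr fun u hu => hmin u (Finset.mem_insert_of_mem hu)
    · intro r hr t ht hrt hcons
      rcases Finset.mem_insert.1 ht with rfl | ht
      · have hrπ : r ∈ π := (Finset.mem_insert.1 hr).resolve_left hrt.ne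
        have hrm : r = m := by
          refine le_antisymm (π.le_max' r hrπ) ?_
          exact (hcons m (Finset.mem_insert_of_mem hmπ)).resolve_right (not_le.2 (hlt m hmπ))
        rw [Function.update_self, Function.update_of_ne (hlt r hrπ).ne, hrm]
      · have hrt₀ : r < t₀ := hrt.trans (hlt t ht)
        have hrπ : r ∈ π := (Finset.mem_insert.1 hr).resolve_left hrt₀.ne
        rw [Function.update_of_ne (hlt t ht).ne, Function.update_of_ne hrt₀.ne]
        exact hy r hrπ t ht hrt fun u hu => hcons u (Finset.mem_insert_of_mem hu)

variable {V : Type*} [PseudoMetricSpace V] {ω : ℝ≥0 → ℝ≥0 → ℝ≥0} {ϖ : ℝ≥0 → ℝ≥0} {ϰ δ : ℝ≥0}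
  {T : ℝ≥0∞} {M K : ℝ} {φ : ℝ≥0 → ℝ≥0 → V → V} {y : ℝ≥0 → V} {P : Set ℝ≥0}

/-- The discrete sewing estimate: a scheme along `π` is a D-solution at the times in `π`, with a
constant that does not depend on `π`. The window is cut at two consecutive times of `π`, between
which the scheme makes no error. -/
lemma isDSolution_of_scheme (hφ : IsLipschitzAlmostFlow (fun _ => M) ω ϖ T δ φ) (hω : IsControl ω)
    (hϖ : IsRemainder ϖ ϰ) (hM : 1 ≤ M) (hϰ : ϰ * (1 + δ) < 1) {π : Finset ℝ≥0}
    (hy : ∀ r ∈ π, ∀ t ∈ π, r < t → (∀ u ∈ π, u ≤ r ∨ t ≤ u) → y t = φ t r (y r)) :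
    IsDSolution φ ω ϖ T (sewingConst ϰ δ M) π y := by
  have hθ := halvingFactor_lt_one hϖ hϰ
  have hL := sewingConst_nonneg hM hθ
  have main : ∀ n : ℕ, ∀ r ∈ π, ∀ t ∈ π, r ≤ t → (t : ℝ≥0∞) ≤ r + T →
      (π.filter fun u => r ≤ u ∧ u ≤ t).card ≤ n →
      dist (y t) (φ t r (y r)) ≤ sewingConst ϰ δ M * ϖ (ω r t) := by
    intro n
    induction n with
    | zero =>
      intro r hr t _ hrt _ hcard
      have : r ∈ π.filter fun u => r ≤ u ∧ u ≤ t := by simp [hr, hrt]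
      rw [Finset.card_eq_zero.1 (Nat.le_zero.1 hcard)] at this
      simp at this
    | succ n ih =>
      intro r hr t ht hrt hT hcard
      rcases hrt.eq_or_lt with rfl | hlt
      · rw [hφ.diag, dist_self]
        positivity
      -- `v` is the last time before `t` in the first `ω`-half, `v'` the next one
      have hA : (π.filter fun u => r ≤ u ∧ u < t ∧ ω r u ≤ ω r t / 2).Nonempty :=
        ⟨r, by simp [hr, hlt, hω.diag]⟩
      obtain ⟨v, hvA, hvmax⟩ := Finset.exists_max_image _ id hA
      obtain ⟨hv, hrv, hvt, hωv⟩ := Finset.mem_filter.1 hvA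
      have hB : (π.filter fun u => v < u ∧ u ≤ t).Nonempty := ⟨t, by simp [ht, hvt]⟩
      obtain ⟨v', hvB, hvmin⟩ := Finset.exists_min_image _ id hB
      obtain ⟨hv', hvv', hv't⟩ := Finset.mem_filter.1 hvB
      have hωv' : ω v' t ≤ ω r t / 2 := by
        rcases hv't.eq_or_lt with rfl | hv't'
        · simp [hω.diag]
        have h₁ : ω r t / 2 < ω r v' := by
          by_contra! hcon
          have := hvmax v' (by simp [hv', hrv.trans hvv'.le, hv't', hcon])
          exact absurd hvv' (not_lt.2 this)
        have h₂ := hω.superadditive r v' t (hrv.trans hvv'.le) hv't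
        rw [← NNReal.coe_le_coe] at h₂ ⊢
        rw [← NNReal.coe_lt_coe] at h₁
        push_cast at h₁ h₂ ⊢
        linarith
      have hstep : y v' = φ v' v (y v) := by
        refine hy v hv v' hv' hvv' fun u hu => ?_
        by_contra! hcon
        have := hvmin u (by simp [hu, hcon.1, hcon.2.le.trans hv't])
        exact absurd hcon.2 (not_lt.2 this)
      have hc₁ : (π.filter fun u => r ≤ u ∧ u ≤ v).card ≤ n := by
        refine Nat.le_of_lt_succ (lt_of_lt_of_le (Finset.card_lt_card ?_) hcard)
        refine (Finset.ssubset_iff_of_subset fun u hu => ?_).2 ⟨t, by simp [ht, hrt], by simp [hvt]⟩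
        simp only [Finset.mem_filter] at hu ⊢
        exact ⟨hu.1, hu.2.1, hu.2.2.trans hvt.le⟩
      have hc₂ : (π.filter fun u => v' ≤ u ∧ u ≤ t).card ≤ n := by
        have hrv' := hrv.trans_lt hvv'
        refine Nat.le_of_lt_succ (lt_of_lt_of_le (Finset.card_lt_card ?_) hcard)
        refine (Finset.ssubset_iff_of_subset fun u hu => ?_).2
          ⟨r, by simp [hr, hrt], by simp [hrv']⟩
        simp only [Finset.mem_filter] at hu ⊢
        exact ⟨hu.1, hrv'.le.trans hu.2.1, hu.2.2⟩
      have h := dist_le_of_halves hφ hω hϖ hM hL hrv hvv'.le hv't hT hωv hωv'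
        (ih r hr v hv hrv (window_mono hT le_rfl hvt.le) hc₁)
        (ih v' hv' t ht hv't (window_mono hT (hrv.trans hvv'.le) le_rfl) hc₂)
      rwa [hstep, dist_self, mul_zero, add_zero, halvingFactor_mul_sewingConst M hθ] at h
  exact fun r hr t ht hrt hT => main _ r hr t ht hrt hT le_rfl

lemma IsLipschitzAlmostFlow.continuous_of_window
    (hφ : IsLipschitzAlmostFlow (fun _ => M) ω ϖ T δ φ) {r t : ℝ≥0} (hrt : r ≤ t)
    (hT : (t : ℝ≥0∞) ≤ r + T) : Continuous (φ t r) :=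
  (LipschitzWith.of_dist_le_mul (K := 1 + δ) fun a b => by
    simpa using hφ.dist_le r t hrt hT a b).continuous

/-- The property of being a D-solution is closed for pointwise convergence. -/
lemma isClosed_setOf_isDSolution (hφ : IsLipschitzAlmostFlow (fun _ => M) ω ϖ T δ φ) (K : ℝ)
    (P : Set ℝ≥0) : IsClosed {y : ℝ≥0 → V | IsDSolution φ ω ϖ T K P y} := by
  simp only [IsDSolution, Set.ofPred_forall]
  refine isClosed_iInter fun r => isClosed_iInter fun _ => isClosed_iInter fun t =>
    isClosed_iInter fun _ => isClosed_iInter fun hrt => isClosed_iInter fun hT => ?_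
  exact isClosed_le ((continuous_apply t).dist
    ((hφ.continuous_of_window hrt hT).comp (continuous_apply r))) continuous_const

lemma IsControl.tendsto_right (hω : IsControl ω) (t₀ : ℝ≥0) :
    Tendsto (fun t => ω t₀ t) (𝓝[≥] t₀) (𝓝 0) := by
  rw [← bot_eq_zero, (nhds_bot_basis (α := ℝ≥0)).tendsto_right_iff]
  intro ε hε
  obtain ⟨h, hpos, hh⟩ := hω.small (t₀ + 1) ε hε
  have h₁ : ∀ᶠ t in 𝓝[≥] t₀, t ≤ t₀ + h :=
    nhdsWithin_le_nhds (eventually_le_nhds (lt_add_of_pos_right t₀ hpos))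
  have h₂ : ∀ᶠ t in 𝓝[≥] t₀, t ≤ t₀ + 1 :=
    nhdsWithin_le_nhds (eventually_le_nhds (lt_add_of_pos_right t₀ one_pos))
  filter_upwards [h₁, h₂, self_mem_nhdsWithin] with t ht₁ ht₂ ht₃
  exact hh t₀ t ht₃ ht₁ ht₂

lemma eventually_le_add {t₀ h : ℝ≥0} (hpos : 0 < h) : ∀ᶠ t in 𝓝 t₀, t₀ ≤ t + h := by
  have hc : Tendsto (fun t : ℝ≥0 => t + h) (𝓝 t₀) (𝓝 (t₀ + h)) :=
    (continuous_id.add continuous_const).tendsto t₀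
  exact (hc.eventually_const_lt (lt_add_of_pos_right t₀ hpos)).mono fun _ => le_of_lt

lemma IsControl.tendsto_left (hω : IsControl ω) (t₀ : ℝ≥0) :
    Tendsto (fun t => ω t t₀) (𝓝[≤] t₀) (𝓝 0) := by
  rw [← bot_eq_zero, (nhds_bot_basis (α := ℝ≥0)).tendsto_right_iff]
  intro ε hε
  obtain ⟨h, hpos, hh⟩ := hω.small t₀ ε hε
  have h₁ : ∀ᶠ t in 𝓝[≤] t₀, t₀ ≤ t + h := nhdsWithin_le_nhds (eventually_le_add hpos)
  filter_upwards [h₁, self_mem_nhdsWithin] with t ht₁ ht₃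
  exact hh t t₀ ht₃ ht₁ le_rfl

/-- The growth bound for D-solutions from time `s` to time `t`, by steps of length `τ`. -/
noncomputable def growthBound (ω : ℝ≥0 → ℝ≥0 → ℝ≥0) (ϖ : ℝ≥0 → ℝ≥0) (δ : ℝ≥0) (M K : ℝ)
    (τ s t : ℝ≥0) : ℝ :=
  ⌈t / τ⌉₊ * (δ * M + K * ϖ (ω s t))

lemma growthBound_nonneg (hM : 1 ≤ M) (hK : 0 ≤ K) (τ s t : ℝ≥0) :
    0 ≤ growthBound ω ϖ δ M K τ s t := by
  unfold growthBound; positivity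

lemma IsDSolution.dist_le_growthBound (hφ : IsLipschitzAlmostFlow (fun _ => M) ω ϖ T δ φ)
    (hω : IsControl ω) (hϖ : IsRemainder ϖ ϰ) (hM : 1 ≤ M) (hK : 0 ≤ K) {τ s t : ℝ≥0}
    (hτ₀ : 0 < τ) (hτ : (τ : ℝ≥0∞) ≤ T) (hy : IsDSolution φ ω ϖ T K P y) (hs : s ∈ P) (ht : t ∈ P)
    (hst : s ≤ t) (hP : ∀ i : ℕ, s + i * τ ≤ t → s + i * τ ∈ P) :
    dist (y t) (y s) ≤ growthBound ω ϖ δ M K τ s t := by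
  refine hy.dist_le_mul hφ hω hϖ hM hK hτ hs _ t ht hst ?_ hP
  exact ((div_le_iff₀ hτ₀).1 (Nat.le_ceil (t / τ))).trans le_add_self

/-- D-solutions are continuous. On the left of `t₀` the bound compares `y t₀` with `φ t₀ t (y t)`, and
`y t` varies with `t`; local compactness makes it converge along ultrafilters. -/
lemma IsDSolution.continuousOn [ProperSpace V]
    (hφ : IsLipschitzAlmostFlow (fun _ => M) ω ϖ T δ φ) (hω : IsControl ω) (hϖ : IsRemainder ϖ ϰ)
    (hM : 1 ≤ M) (hK : 0 ≤ K) {τ s : ℝ≥0} (hτ₀ : 0 < τ) (hτ : (τ : ℝ≥0∞) ≤ T)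
    (hy : IsDSolution φ ω ϖ T K (Set.Ici s) y) : ContinuousOn y (Set.Ici s) := by
  intro t₀ ht₀
  rw [ContinuousWithinAt, tendsto_iff_ultrafilter]
  intro g hg
  have hgs : ∀ᶠ t in (g : Filter ℝ≥0), s ≤ t := hg self_mem_nhdsWithin
  have hg₀ : (g : Filter ℝ≥0) ≤ 𝓝 t₀ := hg.trans nhdsWithin_le_nhds
  have hϖ₀ : Tendsto (fun x => K * (ϖ x : ℝ)) (𝓝 0) (𝓝 0) := by
    have hc : Continuous fun x => K * (ϖ x : ℝ) := by
      have := hϖ.continuous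
      fun_prop
    simpa [hϖ.zero] using hc.tendsto 0
  rcases Ultrafilter.em g (fun t => t₀ ≤ t) with hR | hL
  · have hgR : (g : Filter ℝ≥0) ≤ 𝓝[≥] t₀ := le_inf hg₀ (le_principal_iff.2 hR)
    have h₁ : Tendsto (fun t => φ t t₀ (y t₀)) g (𝓝 (y t₀)) := by
      have hc := hφ.continuousFamily (y t₀) (t₀, t₀) (le_refl t₀)
      rw [ContinuousWithinAt, hφ.diag] at hc
      have hp : Tendsto (fun t => (t₀, t)) g (𝓝[{p : ℝ≥0 × ℝ≥0 | p.1 ≤ p.2}] (t₀, t₀)) :=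
        tendsto_nhdsWithin_iff.2 ⟨tendsto_const_nhds.prodMk_nhds (tendsto_id'.2 hg₀), hR⟩
      exact hc.comp hp
    refine h₁.congr_dist ?_
    refine squeeze_zero' (Eventually.of_forall fun _ => dist_nonneg) ?_
      (hϖ₀.comp ((hω.tendsto_right t₀).mono_left hgR))
    filter_upwards [hR, hgs, hg₀ (eventually_le_nhds (lt_add_of_pos_right t₀ hτ₀))] with t h h' h''
    rw [dist_comm]
    exact hy t₀ ht₀ t h' h (window_of_le_add hτ h'')
  · have hL' : ∀ᶠ t in (g : Filter ℝ≥0), t ≤ t₀ := hL.mono fun t h => (not_le.1 h).le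
    have hgL : (g : Filter ℝ≥0) ≤ 𝓝[≤] t₀ := le_inf hg₀ (le_principal_iff.2 hL')
    have hbdd : ∀ᶠ t in (g : Filter ℝ≥0), y t ∈ Metric.closedBall (y s)
        (⌈t₀ / τ⌉₊ * (δ * M + K * ϖ (ω s t₀))) := by
      filter_upwards [hL', hgs] with t h h'
      refine (hy.dist_le_mul hφ hω hϖ hM hK hτ (Set.mem_Ici.2 le_rfl) ⌈t₀ / τ⌉₊ t h' h' ?_
        fun i _ => Set.mem_Ici.2 le_self_add).trans ?_
      · exact (h.trans ((div_le_iff₀ hτ₀).1 (Nat.le_ceil (t₀ / τ)))).trans le_add_self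
      · gcongr
        exact hϖ.strictMono.monotone (hω.mono le_rfl h' h)
    obtain ⟨b, -, hb⟩ := (isCompact_closedBall (y s) _).ultrafilter_le_nhds' (g.map y) hbdd
    have hyb : Tendsto y g (𝓝 b) := hb
    have h₁ : Tendsto (fun t => φ t₀ t b) g (𝓝 b) := by
      have hc := hφ.continuousFamily b (t₀, t₀) (le_refl t₀)
      rw [ContinuousWithinAt, hφ.diag] at hc
      have hp : Tendsto (fun t => (t, t₀)) g (𝓝[{p : ℝ≥0 × ℝ≥0 | p.1 ≤ p.2}] (t₀, t₀)) :=
        tendsto_nhdsWithin_iff.2 ⟨(tendsto_id'.2 hg₀).prodMk_nhds tendsto_const_nhds, hL'⟩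
      exact hc.comp hp
    have hev : ∀ᶠ t in (g : Filter ℝ≥0), s ≤ t ∧ t ≤ t₀ ∧ (t₀ : ℝ≥0∞) ≤ t + T := by
      filter_upwards [hgs, hL', hg₀ (eventually_le_add hτ₀)] with t h h' h''
      exact ⟨h, h', window_of_le_add hτ h''⟩
    have h₂ : Tendsto (fun t => φ t₀ t (y t)) g (𝓝 b) := by
      refine h₁.congr_dist (squeeze_zero' (Eventually.of_forall fun _ => dist_nonneg)
        (g := fun t => (1 + (δ : ℝ)) * dist b (y t)) ?_ ?_)
      · filter_upwards [hev] with t ht using hφ.dist_le t t₀ ht.2.1 ht.2.2 b (y t)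
      · simpa using ((tendsto_const_nhds (x := b)).dist hyb).const_mul (1 + (δ : ℝ))
    have h₃ : Tendsto (fun t => φ t₀ t (y t)) g (𝓝 (y t₀)) := by
      refine (tendsto_const_nhds (x := y t₀)).congr_dist (squeeze_zero'
        (Eventually.of_forall fun _ => dist_nonneg) ?_
        (hϖ₀.comp ((hω.tendsto_left t₀).mono_left hgL)))
      filter_upwards [hev] with t ht using hy t ht.1 t₀ ht₀ ht.2.1 ht.2.2
    exact hyb.trans (tendsto_nhds_unique_inseparable h₂ h₃).le

end Schemes

/-! ### Selection of a measurable flow -/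

section Selection

variable {V : Type*}

/-- The path `y` before time `r`, continued by `z`. -/
noncomputable def splice (r : ℝ≥0) (y z : ℝ≥0 → V) : ℝ≥0 → V := fun u => if r ≤ u then z u else y u

lemma splice_of_le {r u : ℝ≥0} (h : r ≤ u) (y z : ℝ≥0 → V) : splice r y z u = z u := if_pos h

lemma splice_of_lt {r u : ℝ≥0} (h : u < r) (y z : ℝ≥0 → V) : splice r y z u = y u :=
  if_neg (not_le.2 h)

variable [NormedAddCommGroup V]

/-- The restriction of a path to the times after `r`, by the value `0` before `r`. -/
noncomputable def cut (r : ℝ≥0) (y : ℝ≥0 → V) : ℝ≥0 → V := (Set.Ici r).indicator y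

lemma cut_of_le {r u : ℝ≥0} (h : r ≤ u) (y : ℝ≥0 → V) : cut r y u = y u :=
  Set.indicator_of_mem (Set.mem_Ici.2 h) y

lemma cut_of_lt {r u : ℝ≥0} (h : u < r) (y : ℝ≥0 → V) : cut r y u = 0 :=
  Set.indicator_of_notMem (by simpa using h) y

/-- A family of sets `S s a` of paths issued from `a` at time `s`, from which a measurable flow can be
selected: the sets are nonempty and compact for pointwise convergence, stable under restriction to
later times and under continuation by paths of the family, and depend measurably on `a`. -/
structure IsSelectable [MeasurableSpace V] (S : ℝ≥0 → V → Set (ℝ≥0 → V)) : Prop where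
  nonempty : ∀ s a, (S s a).Nonempty
  isCompact : ∀ s a, IsCompact (S s a)
  start : ∀ s a, ∀ y ∈ S s a, y s = a
  cut_mem : ∀ s a, ∀ y ∈ S s a, ∀ r, s ≤ r → cut r y ∈ S r (y r)
  splice_mem : ∀ s a, ∀ y ∈ S s a, ∀ r, s ≤ r → ∀ z ∈ S r (y r), splice r y z ∈ S s a
  measurableSet_hit : ∀ s (F : Set (ℝ≥0 → V)), IsClosed F →
    MeasurableSet {a | (S s a ∩ F).Nonempty}

/-- The paths of `S s a` that maximise `f` at time `q`; no condition if `q` is before the starting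
time `s`. -/
def maximisers (S : ℝ≥0 → V → Set (ℝ≥0 → V)) (q : ℝ≥0) (f : V → ℝ) (s : ℝ≥0) (a : V) :
    Set (ℝ≥0 → V) :=
  {y | y ∈ S s a ∧ (s ≤ q → ∀ z ∈ S s a, f (z q) ≤ f (y q))}

/-- Maximisation keeps a family selectable. Stability under restriction is the principle of dynamic
programming: a better path after time `r` could be spliced in. -/
lemma IsSelectable.maximisers [MeasurableSpace V] {S : ℝ≥0 → V → Set (ℝ≥0 → V)}
    (hS : IsSelectable S) (q : ℝ≥0) {f : V → ℝ} (hf : Continuous f) :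
    IsSelectable (maximisers S q f) := by
  have hfq : Continuous fun y : ℝ≥0 → V => f (y q) := hf.comp (continuous_apply q)
  refine ⟨fun s a => ?_, fun s a => ?_, fun s a y hy => hS.start s a y hy.1,
    fun s a y hy r hsr => ⟨hS.cut_mem s a y hy.1 r hsr, fun hrq z hz => ?_⟩,
    fun s a y hy r hsr z hz => ⟨hS.splice_mem s a y hy.1 r hsr z hz.1, fun hsq w hw => ?_⟩,
    fun s F hF => ?_⟩
  · obtain ⟨y, hy, hmax⟩ := (hS.isCompact s a).exists_isMaxOn (hS.nonempty s a) hfq.continuousOn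
    exact ⟨y, hy, fun _ z hz => hmax hz⟩
  · refine (hS.isCompact s a).inter_right (t := {y | s ≤ q → ∀ z ∈ S s a, f (z q) ≤ f (y q)}) ?_
    simp only [Set.ofPred_forall]
    exact isClosed_iInter fun _ => isClosed_iInter fun z => isClosed_iInter fun _ =>
      isClosed_le continuous_const hfq
  · have h := hy.2 (hsr.trans hrq) _ (hS.splice_mem s a y hy.1 r hsr z hz)
    rwa [splice_of_le hrq, ← cut_of_le hrq y] at h
  · rcases le_or_gt r q with hrq | hrq
    · have h := hz.2 hrq _ (hS.cut_mem s a y hy.1 r hsr)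
      rw [cut_of_le hrq] at h
      rw [splice_of_le hrq]
      exact (hy.2 hsq w hw).trans h
    · rw [splice_of_lt hrq]
      exact hy.2 hsq w hw
  · rcases le_or_gt s q with hsq | hsq
    · have hG : ∀ c : ℚ, IsClosed {y : ℝ≥0 → V | (c : ℝ) ≤ f (y q)} := fun c =>
        isClosed_le continuous_const hfq
      -- the maximum over `S s a ∩ F` is that over `S s a` iff it passes the same rational levels
      have e : {a | (Sewing.maximisers S q f s a ∩ F).Nonempty} = {a | (S s a ∩ F).Nonempty} ∩
          ⋂ c : ℚ, ({a | (S s a ∩ {y | (c : ℝ) ≤ f (y q)}).Nonempty}ᶜ ∪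
            {a | (S s a ∩ (F ∩ {y | (c : ℝ) ≤ f (y q)})).Nonempty}) := by
        ext a
        simp only [Set.mem_inter_iff, Set.mem_iInter, Set.mem_union, Set.mem_compl_iff,
          Set.mem_ofPred_eq]
        constructor
        · rintro ⟨y, ⟨hy, hmax⟩, hyF⟩
          refine ⟨⟨y, hy, hyF⟩, fun c => ?_⟩
          by_cases h : (S s a ∩ {y | (c : ℝ) ≤ f (y q)}).Nonempty
          · obtain ⟨z, hz, hcz⟩ := h
            exact Or.inr ⟨y, hy, hyF, le_trans hcz (hmax hsq z hz)⟩
          · exact Or.inl h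
        · rintro ⟨hne, hc⟩
          obtain ⟨y, ⟨hy, hyF⟩, hmax⟩ :=
            ((hS.isCompact s a).inter_right hF).exists_isMaxOn hne hfq.continuousOn
          refine ⟨y, ⟨hy, fun _ z hz => ?_⟩, hyF⟩
          by_contra! hlt
          obtain ⟨c, hyc, hcz⟩ := exists_rat_btwn hlt
          rcases hc c with h | ⟨w, hw, hwF, hcw⟩
          · exact h ⟨z, hz, hcz.le⟩
          · exact absurd (lt_of_lt_of_le hyc (le_trans hcw (hmax ⟨hw, hwF⟩))) (lt_irrefl _)
      rw [e]
      exact (hS.measurableSet_hit s F hF).inter (MeasurableSet.iInter fun c =>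
        (hS.measurableSet_hit s _ (hG c)).compl.union
          (hS.measurableSet_hit s _ (hF.inter (hG c))))
    · have e : Sewing.maximisers S q f s = S s := by
        ext a y
        exact ⟨fun h => h.1, fun h => ⟨h, fun h' => absurd h' (not_le.2 hsq)⟩⟩
      rw [e]
      exact hS.measurableSet_hit s F hF

variable [SecondCountableTopology V]

/-- Successive maximisation, over all pairs of a time in a dense sequence and a distance to a point of
a dense sequence of `V`. -/
noncomputable def successiveMaximisers (S : ℝ≥0 → V → Set (ℝ≥0 → V)) :
    ℕ → ℝ≥0 → V → Set (ℝ≥0 → V)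
  | 0 => S
  | n + 1 => maximisers (successiveMaximisers S n) (TopologicalSpace.denseSeq ℝ≥0 n.unpair.1)
      fun v => dist v (TopologicalSpace.denseSeq V n.unpair.2)

lemma successiveMaximisers_succ_subset (S : ℝ≥0 → V → Set (ℝ≥0 → V)) (n : ℕ) (s : ℝ≥0) (a : V) :
    successiveMaximisers S (n + 1) s a ⊆ successiveMaximisers S n s a := fun _ hy => hy.1

lemma eq_of_forall_dist_denseSeq_eq {v w : V} (h : ∀ k, dist v (TopologicalSpace.denseSeq V k) =
    dist w (TopologicalSpace.denseSeq V k)) : v = w := by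
  have hd := TopologicalSpace.denseRange_denseSeq V
  have : (fun x => dist v x) = fun x => dist w x :=
    hd.equalizer (by fun_prop) (by fun_prop) (funext h)
  have := congrFun this w
  simpa using this

/-- Selection of a measurable flow: after successive maximisation, a single path is left. -/
theorem IsSelectable.exists_flow [MeasurableSpace V] [BorelSpace V]
    {S : ℝ≥0 → V → Set (ℝ≥0 → V)} (hS : IsSelectable S)
    (hcont : ∀ s a, ∀ y ∈ S s a, ContinuousOn y (Set.Ici s)) :
    ∃ ψ : ℝ≥0 → ℝ≥0 → V → V, IsFlow ψ ∧ (∀ s a, ∃ y ∈ S s a, ∀ t, ψ t s a = y t) ∧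
      ∀ s t, s ≤ t → Measurable (ψ t s) := by
  set R := successiveMaximisers S with hR
  have hRS : ∀ n, IsSelectable (R n) := by
    intro n
    induction n with
    | zero => exact hS
    | succ n ih => exact ih.maximisers _ (by fun_prop)
  have hanti : ∀ s a, Antitone fun n => R n s a := fun s a =>
    antitone_nat_of_succ_le fun n => successiveMaximisers_succ_subset S n s a
  have hne : ∀ s a (F : Set (ℝ≥0 → V)), IsClosed F → (∀ n, (R n s a ∩ F).Nonempty) →
      ((⋂ n, R n s a) ∩ F).Nonempty := by
    intro s a F hF h
    rw [Set.iInter_inter]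
    exact IsCompact.nonempty_iInter_of_sequence_nonempty_isCompact_isClosed _
      (fun n => Set.inter_subset_inter_left F (hanti s a n.le_succ)) h
      (((hRS 0).isCompact s a).inter_right hF)
      fun n => ((hRS n).isCompact s a).isClosed.inter hF
  have hchoice : ∀ s a, ∃ y, ∀ n, y ∈ R n s a := by
    intro s a
    obtain ⟨y, hy, -⟩ := hne s a Set.univ isClosed_univ fun n => by
      simpa using (hRS n).nonempty s a
    exact ⟨y, Set.mem_iInter.1 hy⟩
  have huniq : ∀ s a y z, (∀ n, y ∈ R n s a) → (∀ n, z ∈ R n s a) → ∀ t, s ≤ t → y t = z t := by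
    intro s a y z hy hz
    have hq : ∀ i, s ≤ TopologicalSpace.denseSeq ℝ≥0 i →
        y (TopologicalSpace.denseSeq ℝ≥0 i) = z (TopologicalSpace.denseSeq ℝ≥0 i) := by
      intro i hi
      refine eq_of_forall_dist_denseSeq_eq fun k => ?_
      have h₁ := (hy (Nat.pair i k + 1)).2
      have h₂ := (hz (Nat.pair i k + 1)).2
      simp only [Nat.unpair_pair] at h₁ h₂
      exact le_antisymm (h₂ hi y (hy _)) (h₁ hi z (hz _))
    have hE : Set.EqOn y z (Set.Ioi s ∩ Set.range (TopologicalSpace.denseSeq ℝ≥0)) := by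
      rintro _ ⟨hu, i, rfl⟩
      exact hq i (le_of_lt hu)
    have hEq : Set.EqOn y z (Set.Ici s) := by
      refine hE.of_subset_closure (hcont s a y (hy 0)) (hcont s a z (hz 0))
        (fun u hu => (Set.mem_Ioi.1 hu.1).le) ?_
      rw [← closure_Ioi]
      exact closure_minimal (Dense.open_subset_closure_inter
        (TopologicalSpace.denseRange_denseSeq ℝ≥0) isOpen_Ioi) isClosed_closure
    exact fun t ht => hEq ht
  choose Y hY using hchoice
  refine ⟨fun t s a => Y s a t, ⟨fun t a => hS.start t a _ (hY t a 0), fun r s t hrs hst a => ?_⟩,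
    fun s a => ⟨Y s a, hY s a 0, fun _ => rfl⟩, fun s t hst => ?_⟩
  · have h := huniq s (Y r a s) _ (cut s (Y r a)) (hY s _)
      (fun n => (hRS n).cut_mem r a _ (hY r a n) s hrs) t hst
    rwa [cut_of_le hst] at h
  · refine measurable_of_isClosed fun D hD => ?_
    have hF : IsClosed {y : ℝ≥0 → V | y t ∈ D} := hD.preimage (continuous_apply t)
    have e : (fun a => Y s a t) ⁻¹' D = ⋂ n, {a | (R n s a ∩ {y | y t ∈ D}).Nonempty} := by
      ext a
      simp only [Set.mem_preimage, Set.mem_iInter, Set.mem_ofPred_eq]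
      constructor
      · exact fun h n => ⟨Y s a, hY s a n, h⟩
      · intro h
        obtain ⟨z, hz, hzt⟩ := hne s a _ hF h
        rw [huniq s a _ z (hY s a) (Set.mem_iInter.1 hz) t hst]
        exact hzt
    rw [e]
    exact MeasurableSet.iInter fun n => (hRS n).measurableSet_hit s _ hF

end Selection

/-! ### The sets of D-solutions -/

section Solutions

variable {V : Type*} [NormedAddCommGroup V] {ω : ℝ≥0 → ℝ≥0 → ℝ≥0} {ϖ : ℝ≥0 → ℝ≥0} {ϰ δ : ℝ≥0}
  {T : ℝ≥0∞} {M K : ℝ} {φ : ℝ≥0 → ℝ≥0 → V → V} {y : ℝ≥0 → V}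

/-- The D-solutions with constant `K` issued from `a` at time `s`, extended by `0` before `s`. -/
def solutions (φ : ℝ≥0 → ℝ≥0 → V → V) (ω : ℝ≥0 → ℝ≥0 → ℝ≥0) (ϖ : ℝ≥0 → ℝ≥0) (T : ℝ≥0∞) (K : ℝ)
    (s : ℝ≥0) (a : V) : Set (ℝ≥0 → V) :=
  {y | IsDSolution φ ω ϖ T K (Set.Ici s) y ∧ (∀ u < s, y u = 0) ∧ y s = a}

lemma isClosed_setOf_forall_lt_eq_zero (s : ℝ≥0) : IsClosed {y : ℝ≥0 → V | ∀ u < s, y u = 0} := by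
  simp only [Set.ofPred_forall]
  exact isClosed_iInter fun u => isClosed_iInter fun _ =>
    isClosed_eq (continuous_apply u) continuous_const

/-- The product of balls in which all D-solutions from time `s` with initial norm at most `ρ` live. -/
noncomputable def growthBox (V : Type*) [NormedAddCommGroup V] (ω : ℝ≥0 → ℝ≥0 → ℝ≥0)
    (ϖ : ℝ≥0 → ℝ≥0) (δ : ℝ≥0) (M K : ℝ) (τ s : ℝ≥0) (ρ : ℝ) : Set (ℝ≥0 → V) :=
  Set.univ.pi fun t => Metric.closedBall 0 (ρ + growthBound ω ϖ δ M K τ s t)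

lemma isCompact_growthBox [ProperSpace V] (τ s : ℝ≥0) (ρ : ℝ) :
    IsCompact (growthBox V ω ϖ δ M K τ s ρ) :=
  isCompact_univ_pi fun _ => isCompact_closedBall _ _

lemma solutions_subset_growthBox (hφ : IsLipschitzAlmostFlow (fun _ => M) ω ϖ T δ φ)
    (hω : IsControl ω) (hϖ : IsRemainder ϖ ϰ) (hM : 1 ≤ M) (hK : 0 ≤ K) {τ : ℝ≥0} (hτ₀ : 0 < τ)
    (hτ : (τ : ℝ≥0∞) ≤ T) {s : ℝ≥0} {a : V} {ρ : ℝ} (ha : ‖a‖ ≤ ρ) :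
    solutions φ ω ϖ T K s a ⊆ growthBox V ω ϖ δ M K τ s ρ := by
  rintro y ⟨hy, hy₀, rfl⟩ t -
  have hB := growthBound_nonneg (ω := ω) (ϖ := ϖ) (δ := δ) hM hK τ s t
  rw [mem_closedBall_zero_iff]
  rcases lt_or_ge t s with hts | hst
  · rw [hy₀ t hts, norm_zero]
    linarith [norm_nonneg (y s)]
  · have h := hy.dist_le_growthBound hφ hω hϖ hM hK hτ₀ hτ (Set.mem_Ici.2 le_rfl) hst hst
      fun i _ => Set.mem_Ici.2 le_self_add
    rw [dist_eq_norm] at h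
    linarith [norm_le_norm_add_norm_sub' (y t) (y s)]

/-- Existence of D-solutions: the schemes along finite sets of times live in a compact product of
balls, and each bound in the definition of D-solutions is a closed condition which holds along all
large enough schemes. -/
lemma solutions_nonempty [ProperSpace V] (hφ : IsLipschitzAlmostFlow (fun _ => M) ω ϖ T δ φ)
    (hω : IsControl ω) (hϖ : IsRemainder ϖ ϰ) (hM : 1 ≤ M) (hϰ : ϰ * (1 + δ) < 1) {τ : ℝ≥0}
    (hτ₀ : 0 < τ) (hτ : (τ : ℝ≥0∞) ≤ T) (s : ℝ≥0) (a : V) :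
    (solutions φ ω ϖ T (sewingConst ϰ δ M) s a).Nonempty := by
  classical
  have hL := sewingConst_nonneg hM (halvingFactor_lt_one hϖ hϰ)
  set L := sewingConst ϰ δ M with hLdef
  have hcomp : IsCompact (growthBox V ω ϖ δ M L τ s ‖a‖ ∩
      ({y | ∀ u < s, y u = 0} ∩ {y | y s = a})) :=
    (isCompact_growthBox τ s _).inter_right ((isClosed_setOf_forall_lt_eq_zero s).inter
      (isClosed_eq (continuous_apply s) continuous_const))
  obtain ⟨y, ⟨-, hy₀, hya⟩, hy⟩ := hcomp.inter_iInter_nonempty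
    (fun p : ℝ≥0 × ℝ≥0 => {y | IsDSolution φ ω ϖ T L ({p.1, p.2} ∩ Set.Ici s) y})
    (fun p => isClosed_setOf_isDSolution hφ L _) fun F => by
      set π₀ : Finset ℝ≥0 :=
        insert s ((F.image Prod.fst ∪ F.image Prod.snd).filter fun u => s ≤ u) with hπ₀
      have hsπ₀ : s ∈ π₀ := Finset.mem_insert_self _ _
      have hπ₀s : ∀ u ∈ π₀, s ≤ u := by
        intro u hu
        rcases Finset.mem_insert.1 hu with rfl | hu
        · exact le_rfl
        · exact (Finset.mem_filter.1 hu).2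
      -- a time grid, which makes the growth bound applicable
      obtain ⟨n, hn⟩ := exists_nat_gt (π₀.sup id / τ)
      rw [div_lt_iff₀ hτ₀] at hn
      set π : Finset ℝ≥0 := π₀ ∪ (Finset.range n).image fun i : ℕ => s + i * τ with hπ
      have hsub : π₀ ⊆ π := Finset.subset_union_left
      have hgrid : ∀ t ∈ π₀, ∀ i : ℕ, s + i * τ ≤ t → s + i * τ ∈ π := by
        intro t ht i hi
        refine Finset.mem_union_right _ (Finset.mem_image.2 ⟨i, Finset.mem_range.2 ?_, rfl⟩)
        have h₁ : (i : ℝ≥0) * τ < n * τ :=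
          (le_add_self.trans (hi.trans (Finset.le_sup (f := id) ht))).trans_lt hn
        exact_mod_cast lt_of_mul_lt_mul_right h₁ hτ₀.le
      obtain ⟨x, hxa, hx⟩ := exists_scheme φ a π
      have hxs : x s = a := by
        refine hxa s (hsub hsπ₀) fun u hu => ?_
        rcases Finset.mem_union.1 hu with hu | hu
        · exact hπ₀s u hu
        · obtain ⟨i, -, rfl⟩ := Finset.mem_image.1 hu
          exact le_self_add
      have hxD : IsDSolution φ ω ϖ T L π x := isDSolution_of_scheme hφ hω hϖ hM hϰ hx
      refine ⟨fun t => if t ∈ π₀ then x t else 0, ⟨?_, ?_, ?_⟩, ?_⟩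
      · intro t _
        have hB := growthBound_nonneg (ω := ω) (ϖ := ϖ) (δ := δ) hM hL τ s t
        rw [mem_closedBall_zero_iff]
        by_cases ht : t ∈ π₀
        · simp only [ht, if_true]
          have h := hxD.dist_le_growthBound hφ hω hϖ hM hL hτ₀ hτ (hsub hsπ₀) (hsub ht) (hπ₀s t ht)
            (hgrid t ht)
          rw [dist_eq_norm, hxs] at h
          linarith [norm_le_norm_add_norm_sub' (x t) a]
        · simp only [ht, if_false, norm_zero]
          linarith [norm_nonneg a]
      · intro u hu
        exact if_neg fun h => absurd (hπ₀s u h) (not_le.2 hu)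
      · simp [hsπ₀, hxs]
      · refine Set.mem_iInter₂.2 fun p hp => ?_
        have hmem : ∀ u ∈ ({p.1, p.2} : Set ℝ≥0) ∩ Set.Ici s, u ∈ π₀ := by
          rintro u ⟨hu, hsu⟩
          refine Finset.mem_insert_of_mem (Finset.mem_filter.2 ⟨?_, hsu⟩)
          rcases hu with rfl | rfl
          · exact Finset.mem_union_left _ (Finset.mem_image_of_mem _ hp)
          · exact Finset.mem_union_right _ (Finset.mem_image_of_mem _ hp)
        intro r hr t ht hrt hT
        simp only [hmem r hr, hmem t ht, if_true]
        exact hxD r (hsub (hmem r hr)) t (hsub (hmem t ht)) hrt hT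
  refine ⟨y, fun r hr t ht hrt hT => ?_, hy₀, hya⟩
  exact Set.mem_iInter.1 hy (r, t) r ⟨by simp, hr⟩ t ⟨by simp, ht⟩ hrt hT

/-- Splicing two D-solutions at `r` gives a D-solution with a larger constant, so with the universal
one by the a priori estimate. -/
lemma splice_mem_solutions (hφ : IsLipschitzAlmostFlow (fun _ => M) ω ϖ T δ φ)
    (hω : IsControl ω) (hϖ : IsRemainder ϖ ϰ) (hM : 1 ≤ M) (hϰ : ϰ * (1 + δ) < 1) {s r : ℝ≥0}
    (hsr : s ≤ r) {a : V} {z : ℝ≥0 → V} (hy : y ∈ solutions φ ω ϖ T (sewingConst ϰ δ M) s a)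
    (hz : z ∈ solutions φ ω ϖ T (sewingConst ϰ δ M) r (y r)) :
    splice r y z ∈ solutions φ ω ϖ T (sewingConst ϰ δ M) s a := by
  have hL := sewingConst_nonneg hM (halvingFactor_lt_one hϖ hϰ)
  set L := sewingConst ϰ δ M with hLdef
  obtain ⟨hyD, hy₀, hya⟩ := hy
  obtain ⟨hzD, -, hza⟩ := hz
  have hle : ∀ u, u ≤ r → splice r y z u = y u := by
    intro u hu
    rcases hu.eq_or_lt with rfl | hu
    · rw [splice_of_le le_rfl, hza]
    · exact splice_of_lt hu y z
  refine ⟨?_, fun u hu => (hle u (hu.le.trans hsr)).trans (hy₀ u hu), (hle s hsr).trans hya⟩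
  refine IsDSolution.sewingConst hφ hω hϖ hM hϰ (K := L + (1 + δ) * L + 2 * M) (by positivity) ?_
  intro u hu t ht hut hT
  have hKL : L * ϖ (ω u t) ≤ (L + (1 + δ) * L + 2 * M) * ϖ (ω u t) := by
    gcongr
    have : 0 ≤ (1 + (δ : ℝ)) * L := by positivity
    linarith
  rcases le_total t r with htr | hrt
  · rw [hle t htr, hle u (hut.trans htr)]
    exact (hyD u hu t ht hut hT).trans hKL
  rcases le_total r u with hru | hur
  · rw [splice_of_le hrt, splice_of_le hru]
    exact (hzD u hru t hrt hut hT).trans hKL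
  have h := dist_le_of_split hφ hω hϖ hM hur le_rfl hrt hT (splice r y z)
  rw [hφ.diag, dist_self, mul_zero, add_zero, splice_of_le hrt, hle u hur, splice_of_le le_rfl, hza]
    at h
  have h₁ := hzD r (Set.mem_Ici.2 le_rfl) t hrt hrt (window_mono hT hur le_rfl)
  rw [hza] at h₁
  have h₂ := hyD u hu r hsr hur (window_mono hT le_rfl hrt)
  have h₁' : dist (z t) (φ t r (y r)) ≤ L * ϖ (ω u t) :=
    h₁.trans (by gcongr; exact hϖ.strictMono.monotone (hω.mono hur hrt le_rfl))
  have h₂' : (1 + (δ : ℝ)) * dist (y r) (φ r u (y u)) ≤ (1 + δ) * (L * ϖ (ω u t)) := by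
    gcongr
    exact h₂.trans (by gcongr; exact hϖ.strictMono.monotone (hω.mono le_rfl hur hrt))
  rw [splice_of_le hrt, hle u hur]
  linarith

theorem isSelectable_solutions [ProperSpace V] [MeasurableSpace V] [BorelSpace V]
    (hφ : IsLipschitzAlmostFlow (fun _ => M) ω ϖ T δ φ) (hω : IsControl ω) (hϖ : IsRemainder ϖ ϰ)
    (hM : 1 ≤ M) (hϰ : ϰ * (1 + δ) < 1) {τ : ℝ≥0} (hτ₀ : 0 < τ) (hτ : (τ : ℝ≥0∞) ≤ T) :
    IsSelectable (solutions φ ω ϖ T (sewingConst ϰ δ M)) := by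
  have hL := sewingConst_nonneg hM (halvingFactor_lt_one hϖ hϰ)
  have hcl : ∀ s, IsClosed {y : ℝ≥0 → V |
      IsDSolution φ ω ϖ T (sewingConst ϰ δ M) (Set.Ici s) y ∧ ∀ u < s, y u = 0} := fun s =>
    (isClosed_setOf_isDSolution hφ _ _).inter (isClosed_setOf_forall_lt_eq_zero s)
  refine ⟨solutions_nonempty hφ hω hϖ hM hϰ hτ₀ hτ, fun s a => ?_, fun s a y hy => hy.2.2,
    fun s a y hy r hsr => ⟨?_, fun u hu => cut_of_lt hu y, cut_of_le le_rfl y⟩,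
    fun s a y hy r hsr z hz => splice_mem_solutions hφ hω hϖ hM hϰ hsr hy hz, fun s F hF => ?_⟩
  · refine (isCompact_growthBox τ s _).of_isClosed_subset ?_
      (solutions_subset_growthBox hφ hω hϖ hM hL hτ₀ hτ le_rfl)
    exact (isClosed_setOf_isDSolution hφ _ _).inter ((isClosed_setOf_forall_lt_eq_zero s).inter
      (isClosed_eq (continuous_apply s) continuous_const))
  · intro u hu t ht hut hT
    rw [cut_of_le ht, cut_of_le hu]
    exact hy.1 u (hsr.trans hu) t (hsr.trans ht) hut hT
  · -- the initial values of the solutions in `F`, in a ball, are the image of a compact set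
    have e : {a | (solutions φ ω ϖ T (sewingConst ϰ δ M) s a ∩ F).Nonempty} =
        ⋃ n : ℕ, (fun y : ℝ≥0 → V => y s) '' (growthBox V ω ϖ δ M (sewingConst ϰ δ M) τ s n ∩
          ({y | IsDSolution φ ω ϖ T (sewingConst ϰ δ M) (Set.Ici s) y ∧ ∀ u < s, y u = 0} ∩ F)) := by
      ext a
      simp only [Set.mem_ofPred_eq, Set.mem_iUnion, Set.mem_image]
      constructor
      · rintro ⟨y, hy, hyF⟩
        obtain ⟨n, hn⟩ := exists_nat_ge ‖a‖
        exact ⟨n, y, ⟨solutions_subset_growthBox hφ hω hϖ hM hL hτ₀ hτ hn hy, ⟨hy.1, hy.2.1⟩, hyF⟩,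
          hy.2.2⟩
      · rintro ⟨n, y, ⟨-, ⟨hy, hy₀⟩, hyF⟩, hya⟩
        exact ⟨y, ⟨hy, hy₀, hya⟩, hyF⟩
    rw [e]
    exact MeasurableSet.iUnion fun n => (((isCompact_growthBox τ s _).inter_right
      ((hcl s).inter hF)).image (continuous_apply s)).isClosed.measurableSet

/-- On windows of any bounded length, a D-solution stays close to `φ`, with a constant that depends
on the length. -/
lemma IsDSolution.exists_dist_le (hφ : IsLipschitzAlmostFlow (fun _ => M) ω ϖ T δ φ)
    (hω : IsControl ω) (hϖ : IsRemainder ϖ ϰ) (hM : 1 ≤ M) (hK : 0 ≤ K) {τ : ℝ≥0}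
    (hτ : (τ : ℝ≥0∞) ≤ T) (k : ℕ) :
    ∃ C : ℝ, 0 ≤ C ∧ ∀ (s : ℝ≥0) (y : ℝ≥0 → V), IsDSolution φ ω ϖ T K (Set.Ici s) y →
      ∀ t, s ≤ t → t ≤ s + k * τ → dist (φ t s (y s)) (y t) ≤ C * ϖ (ω s t) := by
  induction k with
  | zero =>
    refine ⟨0, le_rfl, fun s y _ t hst hts => ?_⟩
    obtain rfl : t = s := le_antisymm (by simpa using hts) hst
    simp [hφ.diag]
  | succ k ih =>
    obtain ⟨C, hC, h⟩ := ih
    refine ⟨K + (1 + δ) * C + M, by positivity, fun s y hy t hst hts => ?_⟩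
    have hnn : 0 ≤ (K + (1 + δ) * C + M) * (ϖ (ω s t) : ℝ) := by positivity
    rcases le_total t (s + k * τ) with hle | hle
    · refine (h s y hy t hst hle).trans ?_
      gcongr
      have : 0 ≤ (δ : ℝ) * C := by positivity
      linarith
    · set u := s + k * τ with hu
      have hsu : s ≤ u := le_self_add
      have htu : t ≤ u + τ := hts.trans_eq (by rw [hu]; push_cast; ring)
      have h₁ := h s y hy u hsu le_rfl
      have h₂ := hy u hsu t hst hle (window_of_le_add hτ htu)
      have h₃ := hφ.dist_le u t hle (window_of_le_add hτ htu) (φ u s (y s)) (y u)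
      have h₄ := hφ.dist_comp_le s u t hsu hle (y s)
      have h₁' : (1 + (δ : ℝ)) * dist (φ u s (y s)) (y u) ≤ (1 + δ) * (C * ϖ (ω s t)) := by
        gcongr
        exact h₁.trans (by gcongr; exact hϖ.strictMono.monotone (hω.mono le_rfl hsu hle))
      have h₂' : dist (y t) (φ t u (y u)) ≤ K * ϖ (ω s t) :=
        h₂.trans (by gcongr; exact hϖ.strictMono.monotone (hω.mono hsu hle le_rfl))
      have e₁ := dist_triangle (φ t s (y s)) (φ t u (φ u s (y s))) (y t)
      have e₂ := dist_triangle (φ t u (φ u s (y s))) (φ t u (y u)) (y t)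
      rw [dist_comm] at h₄
      rw [dist_comm] at h₂'
      linarith

end Solutions

end Sewing

theorem theorem3 {V : Type*} [NormedAddCommGroup V] [NormedSpace ℝ V] [FiniteDimensional ℝ V]
    [MeasurableSpace V] [BorelSpace V]
    (N : V → ℝ) (ω : ℝ≥0 → ℝ≥0 → ℝ≥0) (ϖ : ℝ≥0 → ℝ≥0) (ϰ : ℝ≥0) (T : ℝ≥0∞) (δT : ℝ≥0)
    (φ : ℝ≥0 → ℝ≥0 → V → V)
    (hω : Sewing.IsControl ω) (hϖ : Sewing.IsRemainder ϖ ϰ)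
    (hφ : Sewing.IsLipschitzAlmostFlow N ω ϖ T δT φ)
    (hN : BddAbove (Set.range N))
    (hT : 0 < T) (hϰ : ϰ * (1 + δT) < 1) :
    ∃ ψ : ℝ≥0 → ℝ≥0 → V → V,
      Sewing.IsFlow ψ ∧
      (∀ s a, ContinuousOn (fun t => ψ t s a) (Set.Ici s)) ∧
      (∀ H : ℝ≥0∞, H ≤ T ∨ H < ⊤ → Sewing.SameGalaxy N ω ϖ H φ ψ) ∧
      (∀ s t, s ≤ t → Measurable (ψ t s)) := by
  obtain ⟨M, hM⟩ := hN
  have hNM : ∀ a, N a ≤ M := fun a => hM ⟨a, rfl⟩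
  have hM₁ : 1 ≤ M := (hφ.one_le 0).trans (hNM 0)
  have hφM := hφ.of_le hM₁ hNM
  have : ProperSpace V := FiniteDimensional.proper_real V
  obtain ⟨τ, hτ₀, hτ⟩ := ENNReal.lt_iff_exists_nnreal_btwn.1 hT
  have hτ₀' : 0 < τ := by exact_mod_cast hτ₀
  have hL := Sewing.sewingConst_nonneg hM₁ (Sewing.halvingFactor_lt_one hϖ hϰ)
  have hcont : ∀ s a, ∀ y ∈ Sewing.solutions φ ω ϖ T (Sewing.sewingConst ϰ δT M) s a,
      ContinuousOn y (Set.Ici s) := fun s a y hy =>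
    hy.1.continuousOn hφM hω hϖ hM₁ hL hτ₀' hτ.le
  obtain ⟨ψ, hflow, hsol, hmeas⟩ :=
    (Sewing.isSelectable_solutions hφM hω hϖ hM₁ hϰ hτ₀' hτ.le).exists_flow hcont
  -- since `1 ≤ N`, bounds without the factor `N a` suffice
  have hgal : ∀ {C : ℝ}, 0 ≤ C → ∀ a (x : ℝ≥0), C * x ≤ C * N a * x := by
    intro C hC a x
    have := hφ.one_le a
    gcongr
    exact le_mul_of_one_le_right hC this
  refine ⟨ψ, hflow, fun s a => ?_, fun H hH => ?_, hmeas⟩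
  · obtain ⟨y, hy, hψ⟩ := hsol s a
    simpa only [hψ] using hcont s a y hy
  · by_cases hHT : H ≤ T
    · refine ⟨Sewing.sewingConst ϰ δT M, fun a s t hst htH => ?_⟩
      obtain ⟨y, hy, hψ⟩ := hsol s a
      have h := hy.1 s (Set.mem_Ici.2 le_rfl) t hst hst (htH.trans (by gcongr))
      rw [hy.2.2] at h
      rw [hψ, dist_comm]
      exact h.trans (hgal hL a _)
    · lift H to ℝ≥0 using (hH.resolve_left hHT).ne
      obtain ⟨C, hC, hCle⟩ := Sewing.IsDSolution.exists_dist_le hφM hω hϖ hM₁ hL hτ.le ⌈H / τ⌉₊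
      refine ⟨C, fun a s t hst htH => ?_⟩
      obtain ⟨y, hy, hψ⟩ := hsol s a
      have htH' : t ≤ s + H := by exact_mod_cast htH
      have h := hCle s y hy.1 t hst
        (htH'.trans (by gcongr; exact (div_le_iff₀ hτ₀').1 (Nat.le_ceil (H / τ))))
      rw [hy.2.2] at h
      rw [hψ]
      exact h.trans (hgal hC a _)
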